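/- Let $A$ be a unital (complex) $C^*$-algebra and let $x$ be a linear extreme point of its closed unit ball $A_1$, that is, an extreme point of $A_1$ in the usual sense of convexity. Regard every Banach space $X$ as a subspace of its bidual $X^{**}$ via the canonical embedding. Then $x$ is also a linear extreme point of the closed unit ball of $A^{**}$. In particular, $x$ is a weak$^*$-extreme point of $A_1$, and it remains so in all the higher biduals. Here a point of the closed unit ball of a Banach space $X$ is called weak$^*$-extreme if it is a linear extreme point of the closed unit ball of $X$ and remains a linear extreme point of the closed unit ball of $X^{**}$. Explicitly, put $A^{(0)}=A$ and $A^{(2n+2)}=(A^{(2n)})^{**}$ for $n\ge 0$. Then for every $n\ge 0$ the image of $x$ in $A^{(2n)}$ under the canonical embeddings is a weak$^*$-extreme point of the closed unit ball of $A^{(2n)}$. -/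

import Mathlib

open NormedSpace

/-- `x` is a linear extreme point of the closed unit ball of the complex normed space `X`.
Convex combinations have real coefficients, as usual. -/
def IsUnitBallExtreme {X : Type*} [NormedAddCommGroup X] [NormedSpace ℂ X] (x : X) : Prop :=
  x ∈ Set.extremePoints ℝ (Metric.closedBall (0 : X) 1)

/-- `x` is a weak*-extreme point of the closed unit ball of `X`: a linear extreme point of the
unit ball of `X` whose image under the canonical embedding `X → X**` is a linear extreme point of
the unit ball of `X**`. -/
def IsWeakStarExtreme {X : Type*} [NormedAddCommGroup X] [NormedSpace ℂ X] (x : X) : Prop :=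
  IsUnitBallExtreme x ∧ IsUnitBallExtreme (inclusionInDoubleDual ℂ X x)

/-- A complex normed space, bundled with its carrier, so that biduals can be iterated. -/
structure BundledNormedSpace where
  carrier : Type*
  [normedAddCommGroup : NormedAddCommGroup carrier]
  [normedSpace : NormedSpace ℂ carrier]

attribute [instance] BundledNormedSpace.normedAddCommGroup BundledNormedSpace.normedSpace

/-- The higher biduals of `X`: the `n`-th one is the dual of order `2 * n`, so that the zeroth is
`X` itself, the first is `X**`, the second is `X****`, and so on. -/
noncomputable def higherBidual (X : Type*) [NormedAddCommGroup X] [NormedSpace ℂ X] :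
    ℕ → BundledNormedSpace
  | 0 => ⟨X⟩
  | n + 1 => ⟨StrongDual ℂ (StrongDual ℂ (higherBidual X n).carrier)⟩

/-- The canonical embedding of `X` into its `n`-th higher bidual, the composition of the canonical
embeddings of each higher bidual into the next one. -/
noncomputable def toHigherBidual (X : Type*) [NormedAddCommGroup X] [NormedSpace ℂ X] :
    (n : ℕ) → X →L[ℂ] (higherBidual X n).carrier
  | 0 => ContinuousLinearMap.id ℂ X
  | n + 1 => (inclusionInDoubleDual ℂ (higherBidual X n).carrier).comp (toHigherBidual X n)

/-! Extremality alone need not survive in a bidual, but its quantitative form `IsStronglyExtreme`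
does: local reflexivity turns a large perturbation in the bidual into a large one in the space, with
almost the same bounds. This step iterates, so no C⋆-structure on the biduals is needed. In a
C⋆-algebra, extremality makes `x` a partial isometry with `(1 - xx*)A(1 - x*x) = 0` (Kadison). The
parallelogram identity then bounds `y x*x` and `xx* y`, which together determine `y`. -/

section NormedSpace

variable {X : Type*} [NormedAddCommGroup X] [NormedSpace ℂ X]

/-- A point `x` of the closed unit ball is strongly extreme if `y` is small whenever both `x + y`
and `x - y` almost lie in the closed unit ball. -/
def IsStronglyExtreme (x : X) : Prop :=
  ‖x‖ ≤ 1 ∧ ∀ ε > 0, ∃ δ > 0, ∀ y : X, ‖x + y‖ ≤ 1 + δ → ‖x - y‖ ≤ 1 + δ → ‖y‖ ≤ ε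

theorem isUnitBallExtreme_of_forall_norm_le {x : X} (hx : ‖x‖ ≤ 1)
    (h : ∀ y : X, ‖x + y‖ ≤ 1 → ‖x - y‖ ≤ 1 → y = 0) : IsUnitBallExtreme x := by
  refine mem_extremePoints_iff_left.2 ⟨by simpa using hx, ?_⟩
  rintro a ha b hb ⟨s, t, hs, ht, hst, rfl⟩
  rw [mem_closedBall_zero_iff] at ha hb
  set m := min s t with hm
  have hm0 : 0 < m := lt_min hs ht
  have key : ∀ c d : ℝ, 0 ≤ c → 0 ≤ d → c + d = 1 → ‖c • a + d • b‖ ≤ 1 := by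
    intro c d hc hd hcd
    calc ‖c • a + d • b‖ ≤ c * ‖a‖ + d * ‖b‖ := by
          refine (norm_add_le _ _).trans (le_of_eq ?_)
          rw [norm_smul, norm_smul, Real.norm_of_nonneg hc, Real.norm_of_nonneg hd]
      _ ≤ c * 1 + d * 1 := by gcongr
      _ = 1 := by linarith
  have h0 : m • (a - b) = 0 := by
    apply h
    · have e : s • a + t • b + m • (a - b) = (s + m) • a + (t - m) • b := by module
      rw [e]
      exact key _ _ (by positivity) (by linarith [min_le_right s t]) (by linarith)
    · have e : s • a + t • b - m • (a - b) = (s - m) • a + (t + m) • b := by module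
      rw [e]
      exact key _ _ (by linarith [min_le_left s t]) (by positivity) (by linarith)
  have hab : a = b := sub_eq_zero.1 ((smul_eq_zero.1 h0).resolve_left hm0.ne')
  rw [← hab, ← add_smul, hst, one_smul]

theorem IsUnitBallExtreme.eq_zero {x y : X} (hx : IsUnitBallExtreme x) (h₁ : ‖x + y‖ ≤ 1)
    (h₂ : ‖x - y‖ ≤ 1) : y = 0 := by
  have := (mem_extremePoints_iff_left.1 hx).2 (x + y) (by simpa using h₁) (x - y)
    (by simpa using h₂) ⟨1 / 2, 1 / 2, by norm_num, by norm_num, by norm_num, by module⟩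
  simpa using this

theorem IsStronglyExtreme.isUnitBallExtreme {x : X} (hx : IsStronglyExtreme x) :
    IsUnitBallExtreme x := by
  refine isUnitBallExtreme_of_forall_norm_le hx.1 fun y h₁ h₂ => ?_
  refine norm_le_zero_iff.1 (le_of_forall_pos_le_add fun ε hε => ?_)
  obtain ⟨δ, hδ, h⟩ := hx.2 ε hε
  simpa using h y (by linarith) (by linarith)

theorem exists_norm_eq_one_mul_eq_norm (w : ℂ) : ∃ c : ℂ, ‖c‖ = 1 ∧ c * w = ‖w‖ := by
  by_cases hw : w = 0
  · exact ⟨1, by simp [hw]⟩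
  · have hw' : (‖w‖ : ℂ) ≠ 0 := by simpa using hw
    refine ⟨(‖w‖ : ℂ) / w, by simp [hw], by field_simp⟩

theorem mul_norm_le_of_forall_re_le {r t : ℝ} (hr : 0 < r) (g : StrongDual ℂ X)
    (h : ∀ a : X, ‖a‖ < r → (g a).re ≤ t) : r * ‖g‖ ≤ t := by
  by_contra! hlt
  have : t / r < ‖g‖ := by rwa [div_lt_iff₀ hr, mul_comm]
  obtain ⟨a, ha, hga⟩ := g.exists_lt_apply_of_lt_opNorm this
  obtain ⟨c, hc, hcg⟩ := exists_norm_eq_one_mul_eq_norm (g a)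
  have h1 := h (((r : ℂ) * c) • a) (by
    rw [norm_smul, norm_mul, hc, Complex.norm_real, Real.norm_of_nonneg hr.le]
    nlinarith)
  rw [map_smul, smul_eq_mul, mul_assoc, hcg, ← Complex.ofReal_mul, Complex.ofReal_re] at h1
  rw [div_lt_iff₀ hr] at hga
  linarith

/-- If `Re g` is bounded below on a level set of a nonzero functional `f`, then `g` is a multiple
of `f`. -/
theorem exists_eq_smul_of_forall_le_re {f g : StrongDual ℂ X} {u : X} {s : ℝ} (hu : f u ≠ 0)
    (h : ∀ y, f y = f u → s ≤ (g y).re) : ∃ μ : ℂ, g = μ • f := by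
  have hker : ∀ y, f y = 0 → g y = 0 := by
    intro y hy
    by_contra hne
    have := h (u + (((s - 1 - (g u).re : ℝ) : ℂ) / g y) • y) (by simp [hy])
    rw [map_add, map_smul, smul_eq_mul, div_mul_cancel₀ _ hne, Complex.add_re,
      Complex.ofReal_re] at this
    linarith
  refine ⟨g u / f u, ContinuousLinearMap.ext fun y => ?_⟩
  have := hker (y - (f y / f u) • u) (by simp [hu])
  rw [map_sub, map_smul, sub_eq_zero] at this
  rw [this]
  simp only [smul_apply, smul_eq_mul]
  field_simp

/-- A form of local reflexivity: if `x + z` and `x - z` have norm less than `r` in the bidual, and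
`z f ≠ 0`, then there is `y : X` with `f y = z f` for which `x + y` and `x - y` have norm less than
`r`. -/
theorem exists_apply_eq_of_norm_inclusionInDoubleDual_le {x : X} {f : StrongDual ℂ X}
    {r r' : ℝ} (hr : 0 < r) (hr' : r' < r) {z : StrongDual ℂ (StrongDual ℂ X)} (hz : z f ≠ 0)
    (h₁ : ‖inclusionInDoubleDual ℂ X x + z‖ ≤ r') (h₂ : ‖inclusionInDoubleDual ℂ X x - z‖ ≤ r') :
    ∃ y, ‖x + y‖ < r ∧ ‖x - y‖ < r ∧ f y = z f := by
  by_contra! hno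
  -- If no such `y` exists, the diagonal slice `f = z f` of `X × X` misses a sup-norm ball, and
  -- Hahn–Banach separates them.
  have hdisj : Disjoint (Metric.ball ((-x, x) : X × X) r) {p | p.1 = p.2 ∧ f p.1 = z f} := by
    refine Set.disjoint_left.2 ?_
    rintro ⟨a, b⟩ hab ⟨hab', hf⟩
    obtain rfl : a = b := hab'
    rw [mem_ball_iff_norm, Prod.mk_sub_mk, Prod.norm_mk, max_lt_iff] at hab
    refine hno a ?_ ?_ hf
    · rw [add_comm]; simpa using hab.1
    · rw [norm_sub_rev]; exact hab.2
  have hconv : Convex ℝ {p : X × X | p.1 = p.2 ∧ f p.1 = z f} := by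
    rintro ⟨a, a'⟩ ⟨h1, h2⟩ ⟨b, b'⟩ ⟨h3, h4⟩ s t hs ht hst
    dsimp only at h1 h2 h3 h4
    subst h1 h3
    refine ⟨rfl, ?_⟩
    have : f (s • a + t • b) = (s : ℂ) * f a + (t : ℂ) * f b := by
      rw [map_add, ← Complex.coe_smul s a, ← Complex.coe_smul t b, map_smul, map_smul,
        smul_eq_mul, smul_eq_mul]
    refine this.trans ?_
    rw [h2, h4, ← add_mul, ← Complex.ofReal_add, hst, Complex.ofReal_one, one_mul]
  obtain ⟨F, s, hF₁, hF₂⟩ := RCLike.geometric_hahn_banach_open (𝕜 := ℂ)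
    (convex_ball ((-x, x) : X × X) r) Metric.isOpen_ball hconv hdisj
  set F₁ : StrongDual ℂ X := F.comp (ContinuousLinearMap.inl ℂ X X) with hF₁def
  set F₂ : StrongDual ℂ X := F.comp (ContinuousLinearMap.inr ℂ X X) with hF₂def
  have hF : ∀ a b, F (a, b) = F₁ a + F₂ b := by
    intro a b
    simp [hF₁def, hF₂def, ← map_add]
  have hball : ∀ a b : X, ‖a‖ < r → ‖b‖ < r →
      (F₁ a).re + (F₂ b).re - (F₁ x).re + (F₂ x).re < s := by
    intro a b ha hb
    have := hF₁ (a - x, b + x) (by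
      rw [mem_ball_iff_norm, Prod.mk_sub_mk, Prod.norm_mk, max_lt_iff]
      constructor <;> simpa)
    rw [hF] at this
    simp at this
    linarith
  have hb1 : r * ‖F₁‖ + r * ‖F₂‖ - (F₁ x).re + (F₂ x).re ≤ s := by
    have h2 : r * ‖F₂‖ ≤ s - r * ‖F₁‖ + (F₁ x).re - (F₂ x).re := by
      refine mul_norm_le_of_forall_re_le hr F₂ fun b hb => ?_
      have := mul_norm_le_of_forall_re_le hr F₁
        (t := s + (F₁ x).re - (F₂ x).re - (F₂ b).re) fun a ha => by linarith [hball a b ha hb]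
      linarith
    linarith
  obtain ⟨v, hv⟩ : ∃ v, f v ≠ 0 := by
    by_contra! hf
    exact hz (by rw [show f = 0 from ContinuousLinearMap.ext hf, map_zero])
  set u := (z f / f v) • v with hudef
  have hu : f u = z f := by simp [hudef, hv]
  have hG : ∀ y, f y = f u → s ≤ ((F₁ + F₂) y).re := by
    intro y hy
    have := hF₂ (y, y) ⟨rfl, hy.trans hu⟩
    rw [hF] at this
    simpa using this
  obtain ⟨μ, hμ⟩ := exists_eq_smul_of_forall_le_re (hu.trans_ne hz) hG
  -- On multiples of `f`, `z` acts as evaluation at `u`, so the separation bound passes to `z`.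
  have hzG : z (F₁ + F₂) = (F₁ + F₂) u := by
    rw [hμ, map_smul, smul_apply, hu]
  have hs : s ≤ (z F₁).re + (z F₂).re := by
    have := hG u rfl
    rwa [← hzG, map_add, Complex.add_re] at this
  have hz1 : (F₁ x).re + (z F₁).re ≤ r' * ‖F₁‖ := by
    have := (Complex.re_le_norm _).trans (ContinuousLinearMap.le_of_opNorm_le _ h₁ F₁)
    simpa using this
  have hz2 : -(F₂ x).re + (z F₂).re ≤ r' * ‖F₂‖ := by
    have := ((neg_le_abs _).trans (Complex.abs_re_le_norm _)).trans (ContinuousLinearMap.le_of_opNorm_le _ h₂ F₂)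
    simp at this
    linarith
  have hN : (r - r') * (‖F₁‖ + ‖F₂‖) ≤ 0 := by linarith
  have hN' : ‖F₁‖ + ‖F₂‖ ≤ 0 := by
    by_contra! hpos
    have := mul_pos (sub_pos.2 hr') hpos
    linarith
  have hF₁0 : F₁ = 0 := norm_le_zero_iff.1 (by linarith [norm_nonneg F₂])
  have hF₂0 : F₂ = 0 := norm_le_zero_iff.1 (by linarith [norm_nonneg F₁])
  have h4 := hball 0 0 (by simpa) (by simpa)
  simp only [hF₁0, hF₂0] at h4 hs
  simp at h4 hs
  linarith

theorem IsStronglyExtreme.inclusionInDoubleDual {x : X} (hx : IsStronglyExtreme x) :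
    IsStronglyExtreme (inclusionInDoubleDual ℂ X x) := by
  refine ⟨(double_dual_bound ℂ X x).trans hx.1, fun ε hε => ?_⟩
  obtain ⟨δ, hδ, h⟩ := hx.2 ε hε
  -- Halving `δ` leaves the strict gap that local reflexivity needs.
  refine ⟨δ / 2, by positivity, fun z h₁ h₂ =>
    ContinuousLinearMap.opNorm_le_bound _ hε.le fun f => ?_⟩
  by_cases hz : z f = 0
  · rw [hz, norm_zero]; positivity
  obtain ⟨y, hy₁, hy₂, hy⟩ := exists_apply_eq_of_norm_inclusionInDoubleDual_le
    (by positivity) (by linarith : 1 + δ / 2 < 1 + δ) hz h₁ h₂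
  rw [← hy, mul_comm]
  exact f.le_opNorm_of_le (h y hy₁.le hy₂.le)

theorem IsStronglyExtreme.isWeakStarExtreme {x : X} (hx : IsStronglyExtreme x) :
    IsWeakStarExtreme x :=
  ⟨hx.isUnitBallExtreme, hx.inclusionInDoubleDual.isUnitBallExtreme⟩

theorem IsStronglyExtreme.toHigherBidual {x : X} (hx : IsStronglyExtreme x) (n : ℕ) :
    IsStronglyExtreme (toHigherBidual X n x) := by
  induction n with
  | zero => exact hx
  | succ n ih => exact ih.inclusionInDoubleDual

end NormedSpace

/-! ### Extreme points of the unit ball of a C⋆-algebra -/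

section CStarAlgebra

variable {A : Type*} [CStarAlgebra A] [PartialOrder A] [StarOrderedRing A]

theorem CStarAlgebra.norm_le_of_star_mul_self_le {a : A} {r : ℝ} (hr : 0 ≤ r)
    (h : star a * a ≤ algebraMap ℝ A (r ^ 2)) : ‖a‖ ≤ r := by
  rw [← CStarAlgebra.norm_le_iff_le_algebraMap _ (by positivity) (star_mul_self_nonneg a),
    CStarRing.norm_star_mul_self] at h
  nlinarith

theorem CStarAlgebra.star_mul_self_le_of_norm_le {a : A} {r : ℝ} (h : ‖a‖ ≤ r) :
    star a * a ≤ algebraMap ℝ A (r ^ 2) := by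
  rw [← CStarAlgebra.norm_le_iff_le_algebraMap _ (by positivity) (star_mul_self_nonneg a),
    CStarRing.norm_star_mul_self]
  nlinarith [norm_nonneg a]

/-- Extreme points of the unit ball of a C⋆-algebra are partial isometries. -/
theorem IsUnitBallExtreme.mul_star_mul_self {x : A} (hx : IsUnitBallExtreme x) :
    x * (star x * x) = x := by
  have hx1 : ‖x‖ ≤ 1 := by simpa using hx.1
  set k := star x * x with hk
  have hk1 : k ≤ 1 := by simpa using CStarAlgebra.star_mul_self_le_of_norm_le hx1
  have hks : star k = k := by simp [hk]
  have hkn : ‖k‖ ≤ 1 := by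
    rw [hk, CStarRing.norm_star_mul_self]; nlinarith [norm_nonneg x]
  have h1 : ‖x * (3 - k)‖ ≤ 2 := by
    apply CStarAlgebra.norm_le_of_star_mul_self_le (by norm_num)
    have h4 : (0 : A) ≤ 4 - k := by
      have h3 : (0 : A) ≤ 3 := by simp
      rw [show 4 - k = 3 + (1 - k) by rw [← add_sub_assoc]; norm_num]
      exact add_nonneg h3 (sub_nonneg.2 hk1)
    have h5 := star_left_conjugate_nonneg h4 (1 - k)
    have e1 : star (x * (3 - k)) * (x * (3 - k)) = (3 - k) * k * (3 - k) := by
      rw [star_mul, star_sub, hks, hk]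
      simp [mul_assoc]
    rw [star_sub, star_one, hks] at h5
    rw [e1, show algebraMap ℝ A (2 ^ 2) = 4 by
      rw [show (2 : ℝ) ^ 2 = (4 : ℕ) by norm_num, map_natCast]; norm_num, ← sub_nonneg]
    -- The operator form of `t(3 - t)² ≤ 4` on `[0, 1]`.
    have e2 : 4 - (3 - k) * k * (3 - k) = (1 - k) * (4 - k) * (1 - k) := by
      simp only [sub_mul, mul_sub, one_mul, mul_one, show (4 : A) = 1 + 1 + 1 + 1 by norm_num,
        show (3 : A) = 1 + 1 + 1 by norm_num, add_mul, mul_add]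
      abel
    rwa [e2]
  have h2 : ‖x * (1 + k)‖ ≤ 2 := by
    rw [mul_add, mul_one]
    calc ‖x + x * k‖ ≤ ‖x‖ + ‖x‖ * ‖k‖ := (norm_add_le _ _).trans (by gcongr; exact norm_mul_le _ _)
      _ ≤ 1 + 1 * 1 := by gcongr
      _ = 2 := by norm_num
  have h0 : (1 / 2 : ℝ) • (x - x * k) = 0 := by
    apply hx.eq_zero
    · have e : x + (1 / 2 : ℝ) • (x - x * k) = (1 / 2 : ℝ) • (x * (3 - k)) := by
        rw [mul_sub, show x * 3 = x + x + x by noncomm_ring]; module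
      rw [e, norm_smul]; norm_num; linarith
    · have e : x - (1 / 2 : ℝ) • (x - x * k) = (1 / 2 : ℝ) • (x * (1 + k)) := by
        rw [mul_add, mul_one]; module
      rw [e, norm_smul]; norm_num; linarith
  have := (smul_eq_zero.1 h0).resolve_left (by norm_num)
  exact (sub_eq_zero.1 this).symm

/-- A nonzero element of this corner, once normalized, has range and support orthogonal to those of
`x`, so adding or subtracting it keeps `x` in the ball. -/
theorem IsUnitBallExtreme.sub_mul_mul_sub_eq_zero {x : A} (hx : IsUnitBallExtreme x) (a : A) :
    (1 - x * star x) * a * (1 - star x * x) = 0 := by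
  have hpi := hx.mul_star_mul_self
  have hpi' : star x * x * star x = star x := by simpa [mul_assoc] using congrArg star hpi
  have hp : IsStarProjection (star x * x) :=
    ⟨by rw [IsIdempotentElem, mul_assoc, hpi], by simp [IsSelfAdjoint]⟩
  set e := 1 - star x * x with he
  have hee : e * e = e := hp.one_sub.isIdempotentElem
  have hes : star e = e := hp.one_sub.isSelfAdjoint
  have key : ∀ b : A, star x * b = 0 → b * e = b → ‖b‖ ≤ 1 → ‖x + b‖ ≤ 1 := by
    intro b hb1 hb2 hb
    apply CStarAlgebra.norm_le_of_star_mul_self_le zero_le_one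
    have hb3 : star b * x = 0 := by simpa using congrArg star hb1
    have h1 : star b * b ≤ 1 := by simpa using CStarAlgebra.star_mul_self_le_of_norm_le hb
    have h2 := star_left_conjugate_le_conjugate h1 e
    have h3 : star e * (star b * b) * e = star b * b := by
      rw [← mul_assoc, ← star_mul, hb2, mul_assoc, hb2]
    rw [h3, mul_one, hes, hee] at h2
    have h4 : star (x + b) * (x + b) = star x * x + star b * b := by
      rw [star_add, add_mul, mul_add, mul_add, hb1, hb3]; abel
    rw [h4, one_pow, map_one]
    calc star x * x + star b * b ≤ star x * x + e := by gcongr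
      _ = 1 := by simp [he]
  set b := (1 - x * star x) * a * e with hbdef
  have hb1 : star x * b = 0 := by
    have : star x * (1 - x * star x) = 0 := by rw [mul_sub, ← mul_assoc, hpi', mul_one, sub_self]
    rw [hbdef, ← mul_assoc, ← mul_assoc, this, zero_mul, zero_mul]
  have hb2 : b * e = b := by rw [hbdef, mul_assoc, hee]
  by_contra hne
  have hn : ‖b‖ ≠ 0 := norm_ne_zero_iff.2 hne
  have hcn : ‖‖b‖⁻¹ • b‖ ≤ 1 := by rw [norm_smul, norm_inv, norm_norm, inv_mul_cancel₀ hn]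
  have h0 : ‖b‖⁻¹ • b = 0 := by
    apply hx.eq_zero
    · exact key _ (by simp [hb1]) (by rw [smul_mul_assoc, hb2]) hcn
    · rw [sub_eq_add_neg]
      exact key _ (by simp [hb1]) (by rw [neg_mul, smul_mul_assoc, hb2]) (by rwa [norm_neg])
  exact hne ((smul_eq_zero.1 h0).resolve_left (inv_ne_zero hn))

/-- Averaging the two bounds gives `x*x + y*y ≤ r²`; compressing by the projection `x*x` cancels the
first term against 1. -/
theorem norm_mul_star_mul_self_le {x y : A} (hx : x * (star x * x) = x) {r : ℝ} (hr : 1 ≤ r)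
    (h₁ : ‖x + y‖ ≤ r) (h₂ : ‖x - y‖ ≤ r) : ‖y * (star x * x)‖ ≤ √(r ^ 2 - 1) := by
  have hr0 : 0 ≤ r ^ 2 - 1 := by nlinarith
  have hp : IsStarProjection (star x * x) :=
    ⟨by rw [IsIdempotentElem, mul_assoc, hx], by simp [IsSelfAdjoint]⟩
  set p := star x * x with hpdef
  have hpp : p * p = p := hp.isIdempotentElem
  have hps : star p = p := hp.isSelfAdjoint
  apply CStarAlgebra.norm_le_of_star_mul_self_le (Real.sqrt_nonneg _)
  rw [Real.sq_sqrt hr0]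
  have h3 := add_le_add (CStarAlgebra.star_mul_self_le_of_norm_le h₁)
    (CStarAlgebra.star_mul_self_le_of_norm_le h₂)
  have e1 : star (x + y) * (x + y) + star (x - y) * (x - y)
      = (2 : ℝ) • (p + star y * y) := by
    rw [star_add, star_sub, two_smul, hpdef]; noncomm_ring
  rw [e1, ← two_smul ℝ (algebraMap ℝ A _)] at h3
  have h4 : p + star y * y ≤ algebraMap ℝ A (r ^ 2) := by
    have := smul_le_smul_of_nonneg_left h3 (by norm_num : (0 : ℝ) ≤ 1 / 2)
    simpa [smul_smul] using this
  have h5 := star_left_conjugate_le_conjugate h4 p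
  have e2 : star p * (p + star y * y) * p = p + star (y * p) * (y * p) := by
    rw [star_mul y p, hps, mul_add, add_mul, hpp, hpp]; simp only [mul_assoc]
  have e3 : star p * algebraMap ℝ A (r ^ 2) * p = (r ^ 2) • p := by
    rw [hps, Algebra.algebraMap_eq_smul_one, mul_smul_comm, mul_one, smul_mul_assoc, hpp]
  rw [e2, e3] at h5
  calc star (y * p) * (y * p) ≤ (r ^ 2) • p - p := le_sub_iff_add_le'.2 h5
    _ = (r ^ 2 - 1) • p := by rw [sub_smul, one_smul]
    _ ≤ (r ^ 2 - 1) • 1 := smul_le_smul_of_nonneg_left hp.le_one hr0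
    _ = algebraMap ℝ A (r ^ 2 - 1) := (Algebra.algebraMap_eq_smul_one _).symm

/-- Extreme points of the unit ball of a unital C⋆-algebra are strongly extreme. -/
theorem IsUnitBallExtreme.isStronglyExtreme {x : A} (hx : IsUnitBallExtreme x) :
    IsStronglyExtreme x := by
  refine ⟨by simpa using hx.1, fun ε hε => ?_⟩
  have hpi := hx.mul_star_mul_self
  have hpi' : star x * (star (star x) * star x) = star x := by
    simpa [mul_assoc] using congrArg star hpi
  have hp : IsStarProjection (star x * x) :=
    ⟨by rw [IsIdempotentElem, mul_assoc, hpi], by simp [IsSelfAdjoint]⟩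
  -- With `r = 1 + δ` equal to this root, `√(r² - 1) = ε / 2`, half the allowed error.
  have hr : 1 ≤ √(1 + (ε / 2) ^ 2) := Real.one_le_sqrt.2 (by nlinarith [sq_nonneg (ε / 2)])
  have hr1 : 1 < √(1 + (ε / 2) ^ 2) := by
    rw [Real.lt_sqrt zero_le_one]; nlinarith [sq_pos_of_pos (half_pos hε)]
  have hr2 : √(√(1 + (ε / 2) ^ 2) ^ 2 - 1) = ε / 2 := by
    rw [Real.sq_sqrt (by positivity), add_sub_cancel_left, Real.sqrt_sq (by positivity)]
  refine ⟨√(1 + (ε / 2) ^ 2) - 1, by linarith, fun y h₁ h₂ => ?_⟩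
  rw [add_sub_cancel] at h₁ h₂
  have hy1 := norm_mul_star_mul_self_le hpi hr h₁ h₂
  have hy2 : ‖x * star x * y‖ ≤ √(√(1 + (ε / 2) ^ 2) ^ 2 - 1) := by
    have := norm_mul_star_mul_self_le (y := star y) hpi' hr (by rwa [← star_add, norm_star])
      (by rwa [← star_sub, norm_star])
    rw [← norm_star] at this
    simpa [mul_assoc] using this
  rw [hr2] at hy1 hy2
  have hy3 : ‖1 - star x * x‖ ≤ 1 := hp.one_sub.norm_le
  -- The missing corner `(1 - xx*) y (1 - x*x)` vanishes.
  have e : y = y * (star x * x) + x * star x * y * (1 - star x * x) := by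
    have := hx.sub_mul_mul_sub_eq_zero y
    rw [sub_mul, one_mul, sub_mul, sub_eq_zero] at this
    rw [← this]; noncomm_ring
  calc ‖y‖ = ‖y * (star x * x) + x * star x * y * (1 - star x * x)‖ := congrArg _ e
    _ ≤ ‖y * (star x * x)‖ + ‖x * star x * y‖ * ‖1 - star x * x‖ :=
        (norm_add_le _ _).trans (by gcongr; exact norm_mul_le _ _)
    _ ≤ ε / 2 + ε / 2 * 1 := by gcongr
    _ = ε := by ring

end CStarAlgebra

theorem theoremt {A : Type*} [CStarAlgebra A] (x : A) (hx : IsUnitBallExtreme x) :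
    IsUnitBallExtreme (inclusionInDoubleDual ℂ A x) ∧
      IsWeakStarExtreme x ∧
      ∀ n : ℕ, IsWeakStarExtreme (toHigherBidual A n x) := by
  let _ := CStarAlgebra.spectralOrder A
  have := CStarAlgebra.spectralOrderedRing A
  have h : IsStronglyExtreme x := hx.isStronglyExtreme
  exact ⟨h.inclusionInDoubleDual.isUnitBallExtreme, h.isWeakStarExtreme,
    fun n => (h.toHigherBidual n).isWeakStarExtreme⟩
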